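/- Let $B=(B_u)_{u\ge 0}$ be a standard Brownian motion on a probability space $(\Omega,\mathcal F,\mathbb P)$, let $c_0\in\mathbb R$, and let $a_1,a_2:\mathbb R_+\to\mathbb R$, where $\mathbb R_+=[0,\infty)$, satisfy the following: - $a_1$ and $a_2$ are twice continuously differentiable, and $a_1,a_1',a_1'',a_2,a_2',a_2''$ are bounded; - there are $c_1,c_2\in\mathbb R$ with $\lim_{s\to\infty}a_1(s)=c_1$ and $\lim_{s\to\infty}a_2(s)s=c_2$; - $a_2(s)>0$ and $a_2'(s)<0$ for all $s\ge 0$; - $\sup_{s\ge 0}|a_2'(s)s|<\infty$. Put $G(s,y)=a_1(s)+a_2(s)(c_0s+y)$ and, for $(s,y)\in\mathbb R_+\times\mathbb R$, $$W(s,y)=\sup_{\sigma}\mathbb E\big[G(s+\sigma,\,y+B_\sigma)\big],$$ where the supremum is over all almost surely finite stopping times $\sigma\ge 0$ of the natural filtration of $B$. Then the expectations exist and the supremum is finite for all $(s,y)\in\mathbb R_+\times\mathbb R$, and for every bounded set $R\subset\mathbb R$ there is a constant $L_R>0$ such that $$|W(s_1,y_1)-W(s_2,y_2)|\le L_R\big(|s_1-s_2|+|y_1-y_2|\big)\qquad\text{for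 all }(s_1,y_1),(s_2,y_2)\in\mathbb R_+\times R.$$ -/

import Mathlib

open MeasureTheory ProbabilityTheory Filter Topology Set
open scoped NNReal

/-- The gain function `G(s, y) = a₁(s) + a₂(s) (c₀ s + y)`. -/
def gain (c₀ : ℝ) (a₁ a₂ : ℝ → ℝ) (s y : ℝ) : ℝ :=
  a₁ s + a₂ s * (c₀ * s + y)

/-- `f`, `f'` and `f''` are bounded on `[0, ∞)`; derivatives are one-sided at `0`. -/
structure BoundedUpToSecondDeriv (f : ℝ → ℝ) : Prop where
  bdd₀ : ∃ M : ℝ, ∀ s, 0 ≤ s → |f s| ≤ M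
  bdd₁ : ∃ M : ℝ, ∀ s, 0 ≤ s → |derivWithin f (Ici 0) s| ≤ M
  bdd₂ : ∃ M : ℝ, ∀ s, 0 ≤ s → |iteratedDerivWithin 2 f (Ici 0) s| ≤ M

/-- The standing assumptions on the coefficients `a₁, a₂` of the gain function, as functions
on `[0, ∞)` (values at negative arguments play no role). -/
structure GainAssumptions (a₁ a₂ : ℝ → ℝ) : Prop where
  contDiff₁ : ContDiffOn ℝ 2 a₁ (Ici 0)
  contDiff₂ : ContDiffOn ℝ 2 a₂ (Ici 0)
  bounded₁ : BoundedUpToSecondDeriv a₁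
  bounded₂ : BoundedUpToSecondDeriv a₂
  limit₁ : ∃ c₁ : ℝ, Tendsto a₁ atTop (𝓝 c₁)
  pos₂ : ∀ s, 0 ≤ s → 0 < a₂ s
  limit₂ : ∃ c₂ : ℝ, Tendsto (fun s => a₂ s * s) atTop (𝓝 c₂)
  deriv_neg₂ : ∀ s, 0 ≤ s → derivWithin a₂ (Ici 0) s < 0
  /-- `sup_{s ≥ 0} |a₂'(s) s|` is finite (in particular if `a₂'(s) s → 0` as `s → ∞`). -/
  deriv_mul_bounded₂ : ∃ M : ℝ, ∀ s, 0 ≤ s → |derivWithin a₂ (Ici 0) s * s| ≤ M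

section Stopping

variable {Ω : Type*} {mΩ : MeasurableSpace Ω}

/-- Admissible stopping rules: almost surely finite stopping times of the natural filtration of
the process `B`. Under the law started from `(s, y)` the process `Y_{s+u} = y + B_u` has the same
natural filtration, hence the same stopping times. -/
structure IsAdmissible (P : Measure Ω) (B : ℝ≥0 → Ω → ℝ) (hm : ∀ t, StronglyMeasurable (B t))
    (σ : Ω → WithTop ℝ≥0) : Prop where
  isStoppingTime : IsStoppingTime (Filtration.natural B hm) σ
  ae_finite : ∀ᵐ ω ∂P, σ ω ≠ ⊤

/-- The stopped payoff `G(s + σ, Y_{s+σ})`, where `Y_{s+u} = y + B_u`. -/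
noncomputable def stoppedGain (G : ℝ → ℝ → ℝ) (B : ℝ≥0 → Ω → ℝ) (s y : ℝ)
    (σ : Ω → WithTop ℝ≥0) : Ω → ℝ :=
  stoppedValue (fun (u : ℝ≥0) ω => G (s + u) (y + B u ω)) σ

/-- The set of all expected payoffs `E[G(s + σ, y + B_σ)]` over admissible `σ`. -/
def expectedGains (G : ℝ → ℝ → ℝ) (P : Measure Ω) (B : ℝ≥0 → Ω → ℝ)
    (hm : ∀ t, StronglyMeasurable (B t)) (s y : ℝ) : Set ℝ :=
  {v | ∃ σ, IsAdmissible P B hm σ ∧ v = ∫ ω, stoppedGain G B s y σ ω ∂P}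

/-- The value function `W(s, y) = sup_σ E[G(s + σ, y + B_σ)]`. -/
noncomputable def valueFunction (G : ℝ → ℝ → ℝ) (P : Measure Ω) (B : ℝ≥0 → Ω → ℝ)
    (hm : ∀ t, StronglyMeasurable (B t)) (s y : ℝ) : ℝ :=
  sSup (expectedGains G P B hm s y)

end Stopping

/-! The admissible rules do not depend on the starting point, so one `σ` can be played from both
points and the gains compared path by path. This works because almost surely `|B u| ≤ Z (1 + u)` for
all `u`, with `Z` integrable (`exists_integrable_linear_bound`), while `a₂` and its derivative are
`O(1 / (1 + s))`. The decay absorbs the growth of the path uniformly in time (`abs_gain_le`,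
`abs_gain_sub_gain_le`), so integrability, finiteness and the Lipschitz bound all follow from the
integrability of `Z`. On `[0, 1]`, `Z` comes from dyadic chaining with fourth moments; time
inversion covers `[1, ∞)`. -/

theorem abs_le_add_pow_four_div {x ε : ℝ} (hε : 0 < ε) : |x| ≤ ε + x ^ 4 / ε ^ 3 := by
  rcases le_total |x| ε with h | h
  · have : 0 ≤ x ^ 4 / ε ^ 3 := by positivity
    linarith
  · have h3 : ε ^ 3 ≤ |x| ^ 3 := pow_le_pow_left₀ hε.le h 3
    have : |x| ≤ x ^ 4 / ε ^ 3 := by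
      rw [le_div_iff₀ (by positivity), ← (show Even 4 by decide).pow_abs x, pow_succ' |x| 3]
      exact mul_le_mul_of_nonneg_left h3 (abs_nonneg x)
    linarith

theorem integral_pow_four_gaussianReal (v : ℝ≥0) :
    ∫ x, x ^ 4 ∂gaussianReal 0 v = (v : ℝ) ^ 2 * ∫ x, x ^ 4 ∂gaussianReal 0 1 := by
  have h : (gaussianReal 0 1).map (fun x => √(v : ℝ) * x) = gaussianReal 0 v := by
    rw [gaussianReal_map_const_mul]
    congr 1
    · simp
    · ext; simp
  rw [← h, integral_map (by fun_prop) (by fun_prop)]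
  simp_rw [mul_pow]
  rw [integral_const_mul, show √(v : ℝ) ^ 4 = (√(v : ℝ) ^ 2) ^ 2 by ring, Real.sq_sqrt v.coe_nonneg]

/-! ### Integrable linear growth bound for Brownian motion -/

section BrownianBounds

variable {Ω : Type*} {mΩ : MeasurableSpace Ω} {P : Measure Ω} {B X : ℝ≥0 → Ω → ℝ}

theorem integrable_increment_pow_four (hX : IsPreBrownianReal X P) (s t : ℝ≥0) :
    Integrable (fun ω => (X s ω - X t ω) ^ 4) P := by
  have h : MemLp (fun ω => X s ω - X t ω) 4 P :=
    (hX.isGaussianProcess.hasGaussianLaw_fun_sub).memLp (by simp)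
  have := h.integrable_norm_pow (by norm_num)
  simpa [(show Even 4 by decide).pow_abs] using this

theorem integral_increment_pow_four (hX : IsPreBrownianReal X P) (s t : ℝ≥0) :
    ∫ ω, (X s ω - X t ω) ^ 4 ∂P
      = ((nndist (s : ℝ) t : ℝ≥0) : ℝ) ^ 2 * ∫ x, x ^ 4 ∂gaussianReal 0 1 := by
  rw [← integral_pow_four_gaussianReal]
  exact (hX.hasLaw_sub s t).integral_comp (f := fun x : ℝ => x ^ 4) (by fun_prop)

/-- A bound, at dyadic level `n`, for all increments of `X` between consecutive points of
`2⁻ⁿ ℕ ∩ [0, 1]`. -/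
noncomputable def dyadicIncrementBound (X : ℝ≥0 → Ω → ℝ) (n : ℕ) (ω : Ω) : ℝ :=
  (9 / 10 : ℝ) ^ n + (∑ k ∈ Finset.range (2 ^ n),
    (X (((k + 1 : ℕ) : ℝ≥0) / 2 ^ n) ω - X ((k : ℝ≥0) / 2 ^ n) ω) ^ 4) / ((9 / 10 : ℝ) ^ n) ^ 3

theorem dyadicIncrementBound_nonneg (n : ℕ) (ω : Ω) : 0 ≤ dyadicIncrementBound X n ω := by
  unfold dyadicIncrementBound
  have : ∀ k ∈ Finset.range (2 ^ n), (0 : ℝ) ≤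
      (X (((k + 1 : ℕ) : ℝ≥0) / 2 ^ n) ω - X ((k : ℝ≥0) / 2 ^ n) ω) ^ 4 :=
    fun k _ => by positivity
  have := Finset.sum_nonneg this
  positivity

theorem abs_increment_le_dyadicIncrementBound {n k : ℕ} (hk : k < 2 ^ n) (ω : Ω) :
    |X (((k + 1 : ℕ) : ℝ≥0) / 2 ^ n) ω - X ((k : ℝ≥0) / 2 ^ n) ω|
      ≤ dyadicIncrementBound X n ω := by
  refine (abs_le_add_pow_four_div (ε := (9 / 10 : ℝ) ^ n) (by positivity)).trans ?_
  unfold dyadicIncrementBound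
  gcongr
  exact Finset.single_le_sum (f := fun k : ℕ =>
    (X (((k + 1 : ℕ) : ℝ≥0) / 2 ^ n) ω - X ((k : ℝ≥0) / 2 ^ n) ω) ^ 4)
    (fun k _ => by positivity) (Finset.mem_range.2 hk)

/-- Chaining: a point of level `n + 1` is either of level `n` or one increment to the right of such
a point. -/
theorem abs_dyadic_le_sum (n : ℕ) (ω : Ω) : ∀ k : ℕ, k ≤ 2 ^ n →
    |X ((k : ℝ≥0) / 2 ^ n) ω|
      ≤ |X 0 ω| + |X 1 ω| + ∑ m ∈ Finset.range (n + 1), dyadicIncrementBound X m ω := by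
  induction n with
  | zero =>
    intro k hk
    have h0 := dyadicIncrementBound_nonneg (X := X) 0 ω
    have h1 := abs_nonneg (X 0 ω)
    have h2 := abs_nonneg (X 1 ω)
    have : k = 0 ∨ k = 1 := by simp at hk; omega
    rcases this with rfl | rfl <;> simp <;> linarith
  | succ n ih =>
    intro k hk
    have h0 := dyadicIncrementBound_nonneg (X := X) (n + 1) ω
    have halve (j : ℕ) : ((2 * j : ℕ) : ℝ≥0) / 2 ^ (n + 1) = (j : ℝ≥0) / 2 ^ n := by
      push_cast
      rw [pow_succ', mul_div_mul_left _ _ two_ne_zero]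
    rw [Finset.sum_range_succ]
    rcases Nat.even_or_odd' k with ⟨j, rfl | rfl⟩
    · rw [halve]
      linarith [ih j (by rw [pow_succ'] at hk; omega)]
    · have h1 := ih j (by rw [pow_succ'] at hk; omega)
      have h2 := abs_increment_le_dyadicIncrementBound (X := X) (n := n + 1) (k := 2 * j)
        (by omega) ω
      rw [halve] at h2
      have h3 := abs_sub_abs_le_abs_sub (X (((2 * j + 1 : ℕ) : ℝ≥0) / 2 ^ (n + 1)) ω)
        (X ((j : ℝ≥0) / 2 ^ n) ω)
      linarith

theorem integrable_dyadicIncrementBound (hX : IsPreBrownianReal X P) (n : ℕ) :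
    Integrable (dyadicIncrementBound X n) P := by
  have := hX.isGaussianProcess.isProbabilityMeasure
  exact (integrable_const _).add
    ((integrable_finsetSum _ fun k _ => integrable_increment_pow_four hX _ _).div_const _)

/-- There are `2 ^ n` fourth moments of order `4⁻ⁿ`, divided by `r ^ (3 * n)` with `r = 9 / 10`: the
ratio is `1 / (2 * r ^ 3) = 500 / 729`. Any `r` with `2 * r ^ 3 > 1` and `r < 1` would make both
series converge. -/
theorem integral_dyadicIncrementBound (hX : IsPreBrownianReal X P) (n : ℕ) :
    ∫ ω, dyadicIncrementBound X n ω ∂P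
      = (9 / 10 : ℝ) ^ n + (∫ x, x ^ 4 ∂gaussianReal 0 1) * (500 / 729 : ℝ) ^ n := by
  have := hX.isGaussianProcess.isProbabilityMeasure
  unfold dyadicIncrementBound
  rw [integral_add (integrable_const _)
    ((integrable_finsetSum _ fun k _ => integrable_increment_pow_four hX _ _).div_const _),
    integral_div, integral_finsetSum _ fun k _ => integrable_increment_pow_four hX _ _]
  simp_rw [integral_increment_pow_four hX]
  have hd (k : ℕ) : ((nndist (((((k + 1 : ℕ) : ℝ≥0) / 2 ^ n : ℝ≥0)) : ℝ)
      (((k : ℝ≥0) / 2 ^ n : ℝ≥0) : ℝ) : ℝ≥0) : ℝ) = (1 / 2 : ℝ) ^ n := by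
    rw [coe_nndist, Real.dist_eq]
    push_cast
    rw [← sub_div, add_sub_cancel_left, abs_of_pos (by positivity), one_div, one_div, inv_pow]
  simp_rw [hd]
  simp only [integral_const, probReal_univ, one_smul, Finset.sum_const, Finset.card_range,
    nsmul_eq_mul]
  congr 1
  rw [div_eq_iff (by positivity), ← pow_mul, ← pow_mul, mul_comm n 3, mul_comm n 2, pow_mul, pow_mul]
  push_cast
  rw [mul_assoc (∫ x, x ^ 4 ∂gaussianReal 0 1), ← mul_pow, ← mul_assoc, ← mul_pow, mul_comm]
  norm_num

/-- The supremum of `|X|` over the dyadic points of `[0, 1]` is dominated by an integrable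
random variable. -/
theorem exists_integrable_dyadic_bound (hX : IsPreBrownianReal X P) :
    ∃ Z : Ω → ℝ, Integrable Z P ∧ ∀ᵐ ω ∂P, ∀ n k : ℕ, k ≤ 2 ^ n →
      |X ((k : ℝ≥0) / 2 ^ n) ω| ≤ Z ω := by
  have hint := integrable_dyadicIncrementBound hX
  have hnorm (n : ℕ) : ∫ ω, ‖dyadicIncrementBound X n ω‖ ∂P
      = ∫ ω, dyadicIncrementBound X n ω ∂P :=
    integral_congr_ae (ae_of_all _ fun ω => abs_of_nonneg (dyadicIncrementBound_nonneg n ω))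
  have hsum : Summable fun n => ∫ ω, ‖dyadicIncrementBound X n ω‖ ∂P := by
    simp_rw [hnorm, integral_dyadicIncrementBound hX]
    exact (summable_geometric_of_lt_one (by norm_num) (by norm_num)).add
      ((summable_geometric_of_lt_one (by norm_num) (by norm_num)).mul_left _)
  have htop : ∫⁻ ω, ∑' n, ENNReal.ofReal (dyadicIncrementBound X n ω) ∂P ≠ ⊤ := by
    rw [lintegral_tsum fun n => (hint n).aemeasurable.ennreal_ofReal]
    have (n : ℕ) : ∫⁻ ω, ENNReal.ofReal (dyadicIncrementBound X n ω) ∂P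
        = ENNReal.ofReal (∫ ω, ‖dyadicIncrementBound X n ω‖ ∂P) := by
      rw [hnorm, ofReal_integral_eq_lintegral_ofReal (hint n)
        (ae_of_all _ (dyadicIncrementBound_nonneg n))]
    simp_rw [this]
    exact hsum.tsum_ofReal_ne_top
  have hmeas : AEMeasurable (fun ω => ∑' n, ENNReal.ofReal (dyadicIncrementBound X n ω)) P :=
    AEMeasurable.tsum fun n => (hint n).aemeasurable.ennreal_ofReal
  -- Summing in `ENNReal` keeps the series defined everywhere; `toReal` loses nothing where it is
  -- finite, hence almost everywhere.
  refine ⟨fun ω => |X 0 ω| + |X 1 ω|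
      + (∑' n, ENNReal.ofReal (dyadicIncrementBound X n ω)).toReal,
    ((hX.integrable_eval 0).abs.add (hX.integrable_eval 1).abs).add
      (integrable_toReal_of_lintegral_ne_top hmeas htop), ?_⟩
  filter_upwards [ae_lt_top' hmeas htop] with ω hω n k hk
  refine (abs_dyadic_le_sum n ω k hk).trans (add_le_add_right ?_ _)
  rw [← ENNReal.ofReal_le_iff_le_toReal hω.ne,
    ENNReal.ofReal_sum_of_nonneg fun m _ => dyadicIncrementBound_nonneg m ω]
  exact ENNReal.sum_le_tsum _

/-- Continuity is asked only at `t`, so that the lemma applies to `t * B (1 / t)` away from `0`. -/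
theorem abs_le_of_dyadic_bound {f : ℝ≥0 → ℝ} {z : ℝ}
    (hf : ∀ n k : ℕ, k ≤ 2 ^ n → |f ((k : ℝ≥0) / 2 ^ n)| ≤ z) {t : ℝ≥0} (ht : t ≤ 1)
    (hc : ContinuousAt f t) : |f t| ≤ z := by
  have h2 : Tendsto (fun n : ℕ => (2 : ℝ) ^ n) atTop atTop :=
    tendsto_pow_atTop_atTop_of_one_lt one_lt_two
  have hlim : Tendsto (fun n : ℕ => ((⌊(t : ℝ) * 2 ^ n⌋₊ : ℕ) : ℝ≥0) / 2 ^ n) atTop (𝓝 t) := by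
    rw [← NNReal.tendsto_coe]
    push_cast
    exact (tendsto_nat_floor_mul_div_atTop t.2).comp h2
  refine le_of_tendsto (hc.tendsto.comp hlim).abs (Eventually.of_forall fun n => hf _ _ ?_)
  refine Nat.floor_le_of_le ?_
  push_cast
  exact mul_le_of_le_one_left (by positivity) (by exact_mod_cast ht)

/-- Brownian motion is dominated by `Z (1 + u)` for an integrable random variable `Z`. -/
theorem exists_integrable_linear_bound (hB : IsBrownianReal B P) :
    ∃ Z : Ω → ℝ, Integrable Z P ∧ ∀ᵐ ω ∂P, ∀ u : ℝ≥0, |B u ω| ≤ Z ω * (1 + u) := by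
  obtain ⟨Z, hZ, hZb⟩ := exists_integrable_dyadic_bound hB.toIsPreBrownianReal
  obtain ⟨Z', hZ', hZb'⟩ := exists_integrable_dyadic_bound hB.toIsPreBrownianReal.inv
  refine ⟨fun ω => Z ω + Z' ω, hZ.add hZ', ?_⟩
  filter_upwards [hZb, hZb', hB.cont] with ω h h' hc u
  have hz : 0 ≤ Z ω := (abs_nonneg _).trans (h 0 0 (by simp))
  have hz' : 0 ≤ Z' ω := (abs_nonneg _).trans (h' 0 0 (by simp))
  have hu : (0 : ℝ) ≤ u := u.2
  rcases le_total u 1 with hu1 | hu1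
  · have := abs_le_of_dyadic_bound (f := (B · ω)) h hu1 hc.continuousAt
    nlinarith [mul_nonneg hz hu, mul_nonneg hz' hu]
  · have hu0 : u ≠ 0 := (zero_lt_one.trans_le hu1).ne'
    have hinv : ContinuousAt (fun t : ℝ≥0 => (t : ℝ) * B (1 / t) ω) (1 / u) := by
      have : ContinuousAt (fun t : ℝ≥0 => 1 / t) (1 / u) := by
        simp only [one_div]
        exact continuousAt_inv₀ (by simpa using hu0)
      exact NNReal.continuous_coe.continuousAt.mul
        (ContinuousAt.comp (g := (B · ω)) hc.continuousAt this)
    -- The inverted process at time `1 / u` is `B u / u`, so its bound on `[0, 1]` reads `|B u| ≤ Z'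
    -- * u`.
    have := abs_le_of_dyadic_bound h' (div_le_one_of_le₀ hu1 zero_le) hinv
    rw [one_div_one_div, abs_mul, NNReal.abs_eq, NNReal.coe_div, NNReal.coe_one,
      one_div, inv_mul_le_iff₀ (by positivity)] at this
    nlinarith [mul_nonneg hz hu, mul_nonneg hz' hu]

/-- A process with continuous paths almost surely, evaluated at a random time. -/
theorem aemeasurable_eval_random_time (hm : ∀ t, Measurable (B t))
    (hc : ∀ᵐ ω ∂P, Continuous (B · ω)) {τ : Ω → ℝ≥0} (hτ : Measurable τ) :
    AEMeasurable (fun ω => B (τ ω) ω) P := by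
  -- Setting `B` to zero on a measurable null set makes every path continuous, which gives joint
  -- measurability.
  obtain ⟨A, hA, hAm, hAc⟩ := exists_measurable_superset_of_null (ae_iff.1 hc)
  have hcont : ∀ ω, Continuous fun t => Aᶜ.indicator (B t) ω := by
    intro ω
    by_cases hω : ω ∈ A
    · simpa [hω] using continuous_const
    · have : Continuous (B · ω) := by
        by_contra h
        exact hω (hA h)
      simpa [hω] using this
  have hmeas : Measurable (Function.uncurry fun t => Aᶜ.indicator (B t)) :=
    measurable_uncurry_of_continuous_of_measurable hcont
      fun t => (hm t).indicator hAm.compl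
  refine ⟨fun ω => Aᶜ.indicator (B (τ ω)) ω, hmeas.comp (hτ.prodMk measurable_id), ?_⟩
  filter_upwards [measure_eq_zero_iff_ae_notMem.1 hAc] with ω hω
  simp [hω]

end BrownianBounds

/-! ### Deterministic estimates on the gain -/

theorem BoundedUpToSecondDeriv.abs_sub_le {f : ℝ → ℝ} (hf : BoundedUpToSecondDeriv f)
    (hd : ContDiffOn ℝ 2 f (Ici 0)) :
    ∃ C, ∀ s t, 0 ≤ s → 0 ≤ t → |f s - f t| ≤ C * |s - t| := by
  obtain ⟨C, hC⟩ := hf.bdd₁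
  refine ⟨C, fun s t hs ht => ?_⟩
  exact (convex_Ici (0 : ℝ)).norm_image_sub_le_of_norm_derivWithin_le
    (hd.differentiableOn (by norm_num)) hC ht hs

/-- The consequences of the assumptions on `a₁, a₂` that bound and compare gains, with one
constant. -/
theorem GainAssumptions.exists_bound {a₁ a₂ : ℝ → ℝ} (ha : GainAssumptions a₁ a₂) :
    ∃ C : ℝ, 0 < C ∧ (∀ s, 0 ≤ s → |a₁ s| ≤ C) ∧ (∀ s, 0 ≤ s → |a₂ s| * (1 + s) ≤ C) ∧
      (∀ s t, 0 ≤ s → 0 ≤ t → |a₁ s - a₁ t| ≤ C * |s - t|) ∧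
      (∀ s t, 0 ≤ s → 0 ≤ t → |a₂ s * s - a₂ t * t| ≤ C * |s - t|) ∧
      ∀ s t u, 0 ≤ s → 0 ≤ t → 0 ≤ u →
        |a₂ (s + u) - a₂ (t + u)| * (1 + u) ≤ C * |s - t| := by
  obtain ⟨A, hA⟩ := ha.bounded₁.bdd₀
  obtain ⟨A', hA'⟩ := ha.bounded₁.abs_sub_le ha.contDiff₁
  obtain ⟨M, hM⟩ := ha.bounded₂.bdd₀
  obtain ⟨M', hM'⟩ := ha.bounded₂.bdd₁
  obtain ⟨K, hK⟩ := ha.deriv_mul_bounded₂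
  obtain ⟨c, hc⟩ := ha.limit₂
  have hA0 : 0 ≤ A := (abs_nonneg _).trans (hA 0 le_rfl)
  have hM0 : 0 ≤ M := (abs_nonneg _).trans (hM 0 le_rfl)
  have hM'0 : 0 ≤ M' := (abs_nonneg _).trans (hM' 0 le_rfl)
  have hK0 : 0 ≤ K := (abs_nonneg _).trans (hK 0 le_rfl)
  obtain ⟨N, hN⟩ := eventually_atTop.1 (hc.abs.eventually (gt_mem_nhds (lt_add_one |c|)))
  have hmul : ∀ s, 0 ≤ s → |a₂ s| * s ≤ M * |N| + |c| + 1 := fun s hs => by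
    rcases le_total N s with h | h
    · have := hN s h
      rw [abs_mul, abs_of_nonneg hs] at this
      have : 0 ≤ M * |N| := by positivity
      linarith
    · have := mul_le_mul (hM s hs) (h.trans (le_abs_self N)) hs hM0
      linarith [abs_nonneg c]
  have hder : ∀ s, 0 ≤ s → HasDerivWithinAt a₂ (derivWithin a₂ (Ici 0) s) (Ici 0) s :=
    fun s hs => (ha.contDiff₂.differentiableOn (by norm_num) s hs).hasDerivWithinAt
  have hprod : ∀ s t, 0 ≤ s → 0 ≤ t → |a₂ s * s - a₂ t * t| ≤ (K + M) * |s - t| := by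
    intro s t hs ht
    refine (convex_Ici (0 : ℝ)).norm_image_sub_le_of_norm_hasDerivWithin_le
      (f := fun r => a₂ r * r) (fun r hr => (hder r hr).mul (hasDerivWithinAt_id r _))
      (fun r hr => ?_) ht hs
    rw [mul_one]
    exact (abs_add_le _ _).trans (add_le_add (hK r hr) (hM r hr))
  have hshift : ∀ s t u, 0 ≤ s → 0 ≤ t → 0 ≤ u →
      |a₂ (s + u) - a₂ (t + u)| * (1 + u) ≤ (M' + K) * |s - t| := by
    intro s t u hs ht hu
    -- The mean value inequality is applied on `[u, ∞)`, where `|a₂' r| * (1 + u) ≤ |a₂' r| * (1 +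
    -- r) ≤ M' + K`.
    have h := (convex_Ici u).norm_image_sub_le_of_norm_hasDerivWithin_le (f := a₂)
      (C := (M' + K) / (1 + u)) (x := t + u) (y := s + u)
      (fun r hr => (hder r (hu.trans hr)).mono (Ici_subset_Ici.2 hu)) (fun r hr => ?_)
      (mem_Ici.2 (by linarith)) (mem_Ici.2 (by linarith))
    · rw [Real.norm_eq_abs, Real.norm_eq_abs, add_sub_add_right_eq_sub, div_mul_eq_mul_div,
        le_div_iff₀ (by positivity)] at h
      exact h
    · have hr0 : 0 ≤ r := hu.trans hr
      have h1 := hM' r hr0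
      have h2 := hK r hr0
      rw [abs_mul, abs_of_nonneg hr0] at h2
      rw [Real.norm_eq_abs, le_div_iff₀ (by positivity)]
      have := mul_le_mul_of_nonneg_left (show u ≤ r from hr)
        (abs_nonneg (derivWithin a₂ (Ici 0) r))
      linarith
  have hMN : 0 ≤ M * |N| := by positivity
  have hle {x y C : ℝ} (d : ℝ) (h : x ≤ y * |d|) (hC : y ≤ C) : x ≤ C * |d| :=
    h.trans (mul_le_mul_of_nonneg_right hC (abs_nonneg d))
  have hc0 := abs_nonneg c
  have hA'0 := le_abs_self A'
  have hA'1 := abs_nonneg A'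
  refine ⟨A + |A'| + M + M' + K + M * |N| + |c| + 1, by positivity, fun s hs => ?_,
    fun s hs => ?_, fun s t hs ht => hle _ (hA' s t hs ht) (by linarith),
    fun s t hs ht => hle _ (hprod s t hs ht) (by linarith),
    fun s t u hs ht hu => hle _ (hshift s t u hs ht hu) (by linarith)⟩
  · linarith [hA s hs]
  · linarith [hM s hs, hmul s hs]

theorem abs_gain_le {a₁ a₂ : ℝ → ℝ} {C : ℝ} (c₀ : ℝ)
    (h₁ : ∀ s, 0 ≤ s → |a₁ s| ≤ C) (h₂ : ∀ s, 0 ≤ s → |a₂ s| * (1 + s) ≤ C)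
    {s u y x z : ℝ} (hs : 0 ≤ s) (hu : 0 ≤ u) (hx : |x| ≤ z * (1 + u)) :
    |gain c₀ a₁ a₂ (s + u) (y + x)| ≤ C * (1 + |c₀| + |y| + z) := by
  have hsu : 0 ≤ s + u := add_nonneg hs hu
  have hz : 0 ≤ z := by
    by_contra! h
    nlinarith [abs_nonneg x]
  have ha := abs_nonneg (a₂ (s + u))
  have h2 := h₂ _ hsu
  have e1 : |a₂ (s + u) * (c₀ * (s + u))| ≤ C * |c₀| := by
    rw [abs_mul, abs_mul, abs_of_nonneg hsu]
    nlinarith [abs_nonneg c₀]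
  have e2 : |a₂ (s + u) * y| ≤ C * |y| := by
    rw [abs_mul]
    exact mul_le_mul_of_nonneg_right (by nlinarith) (abs_nonneg y)
  have e3 : |a₂ (s + u) * x| ≤ C * z := by
    rw [abs_mul]
    calc |a₂ (s + u)| * |x| ≤ |a₂ (s + u)| * (z * (1 + (s + u))) := by
          gcongr
          exact hx.trans (by gcongr; linarith)
      _ = |a₂ (s + u)| * (1 + (s + u)) * z := by ring
      _ ≤ C * z := by gcongr
  have e : gain c₀ a₁ a₂ (s + u) (y + x) = a₁ (s + u) + a₂ (s + u) * (c₀ * (s + u))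
      + a₂ (s + u) * y + a₂ (s + u) * x := by unfold gain; ring
  rw [e]
  have t1 := abs_add_le (a₁ (s + u) + a₂ (s + u) * (c₀ * (s + u)) + a₂ (s + u) * y)
    (a₂ (s + u) * x)
  have t2 := abs_add_le (a₁ (s + u) + a₂ (s + u) * (c₀ * (s + u))) (a₂ (s + u) * y)
  have t3 := abs_add_le (a₁ (s + u)) (a₂ (s + u) * (c₀ * (s + u)))
  linarith [h₁ _ hsu]

/-- The drift is grouped as `a₂ s * s`, which is Lipschitz; the path `x` multiplies only a
difference of `a₂`, whose weight `1 + u` in `h₅` cancels the growth of `x`. -/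
theorem abs_gain_sub_gain_le {a₁ a₂ : ℝ → ℝ} {C : ℝ} (c₀ : ℝ)
    (h₂ : ∀ s, 0 ≤ s → |a₂ s| * (1 + s) ≤ C)
    (h₃ : ∀ s t, 0 ≤ s → 0 ≤ t → |a₁ s - a₁ t| ≤ C * |s - t|)
    (h₄ : ∀ s t, 0 ≤ s → 0 ≤ t → |a₂ s * s - a₂ t * t| ≤ C * |s - t|)
    (h₅ : ∀ s t u, 0 ≤ s → 0 ≤ t → 0 ≤ u →
      |a₂ (s + u) - a₂ (t + u)| * (1 + u) ≤ C * |s - t|)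
    {s₁ s₂ u y₁ y₂ x z : ℝ} (hs₁ : 0 ≤ s₁) (hs₂ : 0 ≤ s₂) (hu : 0 ≤ u)
    (hx : |x| ≤ z * (1 + u)) :
    |gain c₀ a₁ a₂ (s₁ + u) (y₁ + x) - gain c₀ a₁ a₂ (s₂ + u) (y₂ + x)|
      ≤ C * (1 + |c₀| + |y₁| + z) * |s₁ - s₂| + C * |y₁ - y₂| := by
  have hsu₁ : 0 ≤ s₁ + u := add_nonneg hs₁ hu
  have hsu₂ : 0 ≤ s₂ + u := add_nonneg hs₂ hu
  have hz : 0 ≤ z := by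
    by_contra! h
    nlinarith [abs_nonneg x]
  have e1 := h₃ _ _ hsu₁ hsu₂
  have e2 := mul_le_mul_of_nonneg_left (h₄ _ _ hsu₁ hsu₂) (abs_nonneg c₀)
  have e3 := h₅ s₁ s₂ u hs₁ hs₂ hu
  have ha := abs_nonneg (a₂ (s₁ + u) - a₂ (s₂ + u))
  rw [add_sub_add_right_eq_sub] at e1 e2
  rw [← abs_mul] at e2
  have e4 : |(a₂ (s₁ + u) - a₂ (s₂ + u)) * y₁| ≤ C * |s₁ - s₂| * |y₁| := by
    rw [abs_mul]
    exact mul_le_mul_of_nonneg_right (by nlinarith) (abs_nonneg _)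
  have e5 : |(a₂ (s₁ + u) - a₂ (s₂ + u)) * x| ≤ C * |s₁ - s₂| * z := by
    rw [abs_mul]
    calc |a₂ (s₁ + u) - a₂ (s₂ + u)| * |x|
        ≤ |a₂ (s₁ + u) - a₂ (s₂ + u)| * (z * (1 + u)) := by gcongr
      _ = |a₂ (s₁ + u) - a₂ (s₂ + u)| * (1 + u) * z := by ring
      _ ≤ C * |s₁ - s₂| * z := by gcongr
  have e6 : |a₂ (s₂ + u) * (y₁ - y₂)| ≤ C * |y₁ - y₂| := by
    rw [abs_mul]
    exact mul_le_mul_of_nonneg_right (by nlinarith [h₂ _ hsu₂, abs_nonneg (a₂ (s₂ + u))])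
      (abs_nonneg _)
  have e : gain c₀ a₁ a₂ (s₁ + u) (y₁ + x) - gain c₀ a₁ a₂ (s₂ + u) (y₂ + x)
      = a₁ (s₁ + u) - a₁ (s₂ + u)
        + c₀ * (a₂ (s₁ + u) * (s₁ + u) - a₂ (s₂ + u) * (s₂ + u))
        + (a₂ (s₁ + u) - a₂ (s₂ + u)) * y₁ + (a₂ (s₁ + u) - a₂ (s₂ + u)) * x
        + a₂ (s₂ + u) * (y₁ - y₂) := by unfold gain; ring
  rw [e]
  refine (abs_add_le _ _).trans (add_le_add ?_ e6)
  refine (abs_add_le _ _).trans ((add_le_add_left (abs_add_le _ _) _).trans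
    ((add_le_add_left (add_le_add_left (abs_add_le _ _) _) _).trans ?_))
  linarith

/-! ### Measurability of payoffs and the value function -/

section ValueFunction

variable {Ω : Type*} {mΩ : MeasurableSpace Ω} {P : Measure Ω} {B : ℝ≥0 → Ω → ℝ}
  {hm : ∀ t, StronglyMeasurable (B t)} {c₀ : ℝ} {a₁ a₂ : ℝ → ℝ} {σ : Ω → WithTop ℝ≥0}

theorem aestronglyMeasurable_stoppedGain (hB : IsBrownianReal B P)
    (h₁ : ContinuousOn a₁ (Ici 0)) (h₂ : ContinuousOn a₂ (Ici 0))
    (hσ : IsAdmissible P B hm σ) {s : ℝ} (hs : 0 ≤ s) (y : ℝ) :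
    AEStronglyMeasurable (stoppedGain (gain c₀ a₁ a₂) B s y σ) P := by
  -- `stoppedValue` evaluates at this same `untopA`, whose value on the null event `σ = ⊤` is
  -- immaterial.
  have hτ : Measurable fun ω => (σ ω).untopA := hσ.isStoppingTime.measurable'.untopA
  have hBτ := aemeasurable_eval_random_time (fun t => (hm t).measurable) hB.cont hτ
  have comp {a : ℝ → ℝ} (h : ContinuousOn a (Ici 0)) :
      Measurable fun ω => a (s + ((σ ω).untopA : ℝ≥0)) :=
    (h.comp_continuous (f := fun u : ℝ≥0 => s + (u : ℝ)) (by fun_prop)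
      (fun u => add_nonneg hs u.coe_nonneg)).measurable.comp hτ
  refine AEMeasurable.aestronglyMeasurable ?_
  exact (comp h₁).aemeasurable.add ((comp h₂).aemeasurable.mul
    (((measurable_const.add hτ.coe_nnreal_real).const_mul c₀).aemeasurable.add
      (aemeasurable_const.add hBτ)))

theorem expectedGains_nonempty (P : Measure Ω) (G : ℝ → ℝ → ℝ) (s y : ℝ) :
    (expectedGains G P B hm s y).Nonempty :=
  ⟨_, fun _ => ((0 : ℝ≥0) : WithTop ℝ≥0), ⟨isStoppingTime_const _ _, by simp⟩, rfl⟩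

end ValueFunction

theorem mainTheorem10 {Ω : Type*} {mΩ : MeasurableSpace Ω} (P : Measure Ω)
    (B : ℝ≥0 → Ω → ℝ) (hm : ∀ t, StronglyMeasurable (B t)) (hB : IsBrownianReal B P)
    (c₀ : ℝ) (a₁ a₂ : ℝ → ℝ) (ha : GainAssumptions a₁ a₂) :
    (∀ s y : ℝ, 0 ≤ s →
      (∀ σ, IsAdmissible P B hm σ → Integrable (stoppedGain (gain c₀ a₁ a₂) B s y σ) P) ∧
      BddAbove (expectedGains (gain c₀ a₁ a₂) P B hm s y)) ∧
    ∀ R : Set ℝ, Bornology.IsBounded R → ∃ L : ℝ, 0 < L ∧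
      ∀ s₁ s₂ y₁ y₂ : ℝ, 0 ≤ s₁ → 0 ≤ s₂ → y₁ ∈ R → y₂ ∈ R →
        |valueFunction (gain c₀ a₁ a₂) P B hm s₁ y₁ - valueFunction (gain c₀ a₁ a₂) P B hm s₂ y₂|
          ≤ L * (|s₁ - s₂| + |y₁ - y₂|) := by
  obtain ⟨C, hC0, h₁, h₂, h₃, h₄, h₅⟩ := ha.exists_bound
  obtain ⟨Z, hZ, hZb⟩ := exists_integrable_linear_bound hB
  have hP : IsProbabilityMeasure P := hB.isGaussianProcess.isProbabilityMeasure
  have hbound (s y : ℝ) (hs : 0 ≤ s) (σ : Ω → WithTop ℝ≥0) :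
      ∀ᵐ ω ∂P, ‖stoppedGain (gain c₀ a₁ a₂) B s y σ ω‖ ≤ C * (1 + |c₀| + |y| + Z ω) := by
    filter_upwards [hZb] with ω hω
    exact abs_gain_le c₀ h₁ h₂ hs (NNReal.coe_nonneg _) (hω _)
  have hdom (y : ℝ) : Integrable (fun ω => C * (1 + |c₀| + |y| + Z ω)) P :=
    ((integrable_const _).add hZ).const_mul C
  have hint (s y : ℝ) (hs : 0 ≤ s) (σ : Ω → WithTop ℝ≥0) (hσ : IsAdmissible P B hm σ) :
      Integrable (stoppedGain (gain c₀ a₁ a₂) B s y σ) P :=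
    (hdom y).mono' (aestronglyMeasurable_stoppedGain hB ha.contDiff₁.continuousOn
      ha.contDiff₂.continuousOn hσ hs y) (hbound s y hs σ)
  have hbdd (s y : ℝ) (hs : 0 ≤ s) :
      BddAbove (expectedGains (gain c₀ a₁ a₂) P B hm s y) := by
    refine ⟨∫ ω, C * (1 + |c₀| + |y| + Z ω) ∂P, ?_⟩
    rintro _ ⟨σ, hσ, rfl⟩
    refine integral_mono_ae (hint s y hs σ hσ) (hdom y) ?_
    filter_upwards [hbound s y hs σ] with ω hω using (le_abs_self _).trans hω
  refine ⟨fun s y hs => ⟨hint s y hs, hbdd s y hs⟩, fun R hR => ?_⟩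
  obtain ⟨K, hK⟩ := hR.exists_norm_le
  have hZ0 : 0 ≤ ∫ ω, Z ω ∂P := by
    refine integral_nonneg_of_ae ?_
    filter_upwards [hZb] with ω hω
    simpa using (abs_nonneg _).trans (hω 0)
  -- One-sided comparison: each `σ` for the first point is reused at the second. Exchanging the
  -- points gives the other side.
  have hdiff (s₁ s₂ y₁ y₂ : ℝ) (hs₁ : 0 ≤ s₁) (hs₂ : 0 ≤ s₂) (hy₁ : y₁ ∈ R) :
      valueFunction (gain c₀ a₁ a₂) P B hm s₁ y₁
        ≤ valueFunction (gain c₀ a₁ a₂) P B hm s₂ y₂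
          + C * (1 + |c₀| + |K| + ∫ ω, Z ω ∂P) * (|s₁ - s₂| + |y₁ - y₂|) := by
    refine csSup_le (expectedGains_nonempty _ _ _ _) ?_
    rintro _ ⟨σ, hσ, rfl⟩
    have hi₂ := hint s₂ y₂ hs₂ σ hσ
    have hg : Integrable (fun ω => C * (1 + |c₀| + |y₁| + Z ω) * |s₁ - s₂| + C * |y₁ - y₂|) P :=
      ((hdom y₁).mul_const _).add (integrable_const _)
    calc ∫ ω, stoppedGain (gain c₀ a₁ a₂) B s₁ y₁ σ ω ∂P
        ≤ ∫ ω, (stoppedGain (gain c₀ a₁ a₂) B s₂ y₂ σ ω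
            + (C * (1 + |c₀| + |y₁| + Z ω) * |s₁ - s₂| + C * |y₁ - y₂|)) ∂P := by
          refine integral_mono_ae (hint s₁ y₁ hs₁ σ hσ) (hi₂.add hg) ?_
          filter_upwards [hZb] with ω hω
          have := (le_abs_self _).trans (abs_gain_sub_gain_le (y₁ := y₁) (y₂ := y₂) c₀ h₂ h₃ h₄ h₅
            hs₁ hs₂ (NNReal.coe_nonneg _) (hω (σ ω).untopA))
          exact sub_le_iff_le_add'.1 this
      _ = ∫ ω, stoppedGain (gain c₀ a₁ a₂) B s₂ y₂ σ ω ∂P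
            + (C * (1 + |c₀| + |y₁| + ∫ ω, Z ω ∂P) * |s₁ - s₂| + C * |y₁ - y₂|) := by
          rw [integral_add hi₂ hg, integral_add ((hdom y₁).mul_const _) (integrable_const _),
            integral_mul_const, integral_const_mul, integral_add (integrable_const _) hZ]
          simp
      _ ≤ _ := by
          refine add_le_add (le_csSup (hbdd s₂ y₂ hs₂) ⟨σ, hσ, rfl⟩) ?_
          have hy : |y₁| ≤ |K| := (hK y₁ hy₁).trans (le_abs_self K)
          rw [mul_add _ |s₁ - s₂|]
          refine add_le_add (by gcongr) (mul_le_mul_of_nonneg_right ?_ (abs_nonneg _))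
          refine le_mul_of_one_le_right hC0.le ?_
          linarith [abs_nonneg c₀, abs_nonneg K]
  refine ⟨C * (1 + |c₀| + |K| + ∫ ω, Z ω ∂P), by positivity,
    fun s₁ s₂ y₁ y₂ hs₁ hs₂ hy₁ hy₂ => abs_sub_le_iff.2 ⟨?_, ?_⟩⟩
  · linarith [hdiff s₁ s₂ y₁ y₂ hs₁ hs₂ hy₁]
  · have := hdiff s₂ s₁ y₂ y₁ hs₂ hs₁ hy₂
    rw [abs_sub_comm s₂, abs_sub_comm y₂] at this
    linarith
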